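/- Fix an optimal (plain) decompressor $D$ and an optimal prefix-free decompressor $E$; both are partial computable functions from binary strings to natural numbers, the domain of $E$ contains no string that is a proper prefix of another one, and each is optimal in its class: for every partial computable (respectively, partial computable prefix-free) $D'$ there is a constant $c$ with $C_D(N)\le C_{D'}(N)+c$ (respectively, $C_E(N)\le C_{D'}(N)+c$) for all $N$, where $C_F(N)=\min\{|p| : F(p)=N\}$ and $\min\emptyset=+\infty$. Let $B(n)=\max\{N : C_D(N)\le n\}$ and $BP(n)=\max\{N : C_E(N)\le n\}$ (undefined if no number has complexity at most $n$, which can happen only for finitely many $n$). Let $(m(k))_{k\in\mathbb N}$ be an a priori probability, i.e. a lower semicomputable sequence of non-negative reals with $\sum_k m(k)<\infty$ such that every other such sequence $m'$ satisfies $m'(k)\le c\,m(k)$ for some constant $c$ and all $k$. Let $BP'(n)$ be the minimal $N$ such that $\sum_{k>N} m(k)<2^{-n}$. Here a sequence of reals $a_n$ is lower (upper) semicomputable if $a_n=\lim_k f(n,k)$ for some total computable rational-valued $f$ that is non-decreasing (non-increasing) in $k$. Theorem. Let $(x_n,y_n)_{n\in\mathbb N}$ be a sequence of pairwise distinct pairs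 of natural numbers with $x_n\le y_n$, where the sequence $x_n$ is lower semicomputable and the sequence $y_n$ is upper semicomputable. Assume that $\sum_n 2^{x_n-y_n}=+\infty$. Then (i) there exists $n$ such that $B(x_n)>BP'(y_n)$; (ii) there exists $n$ such that $BP'(x_n)>BP(y_n)$. (In (i) and (ii) it is part of the claim that $B(x_n)$, respectively $BP(y_n)$, is defined.) -/

import Mathlib

open Filter Topology

noncomputable section

namespace BusyBeaver

/-! Kolmogorov complexity. -/

/-- A decompressor takes binary strings to natural numbers and is partial. -/
abbrev Decompressor : Type := List Bool →. ℕ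

/-- Complexity of `N` with respect to `D`: the minimal length of a program `p` with `D p = N`,
and `⊤` if there is no such program. -/
def complexity (D : Decompressor) (N : ℕ) : ℕ∞ :=
  ⨅ p : List Bool, ⨅ _ : N ∈ D p, (p.length : ℕ∞)

/-- No element of the domain is a prefix of another element of the domain. -/
def PrefixFree (D : Decompressor) : Prop :=
  ∀ p q : List Bool, (D p).Dom → (D q).Dom → p <+: q → p = q

/-- `D` is an optimal plain decompressor, so `complexity D` is plain Kolmogorov complexity. -/
def IsOptimal (D : Decompressor) : Prop :=
  Partrec D ∧
    ∀ D' : Decompressor, Partrec D' →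
      ∃ c : ℕ, ∀ N : ℕ, complexity D N ≤ complexity D' N + c

/-- `D` is an optimal prefix-free decompressor, so `complexity D` is prefix Kolmogorov
complexity. -/
def IsOptimalPrefixFree (D : Decompressor) : Prop :=
  Partrec D ∧ PrefixFree D ∧
    ∀ D' : Decompressor, Partrec D' → PrefixFree D' →
      ∃ c : ℕ, ∀ N : ℕ, complexity D N ≤ complexity D' N + c

/-- The numbers of complexity at most `n`. -/
def describable (D : Decompressor) (n : ℕ) : Set ℕ := {N : ℕ | complexity D N ≤ n}

/-- The largest number of complexity at most `n`. For an optimal plain decompressor this is the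
plain busy beaver function, for an optimal prefix-free decompressor the prefix one. -/
def busyBeaver (D : Decompressor) (n : ℕ) : ℕ := sSup (describable D n)

/-- The supremum in `busyBeaver` is a maximum as soon as some number has complexity at most `n`
(so the value `0` that `sSup` gives by default occurs only for an empty set). -/
theorem isGreatest_busyBeaver (D : Decompressor) (n : ℕ) (h : (describable D n).Nonempty) :
    IsGreatest (describable D n) (busyBeaver D n) := by
  have hfin : (describable D n).Finite := by
    have hP : {p : List Bool | p.length ≤ n}.Finite := List.finite_length_le Bool n
    refine (hP.biUnion (t := fun p => {N : ℕ | N ∈ D p}) fun p _ => ?_).subset ?_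
    · exact Set.Subsingleton.finite fun a ha b hb => Part.mem_unique ha hb
    · intro N hN
      have hlt : complexity D N < ((n + 1 : ℕ) : ℕ∞) :=
        lt_of_le_of_lt hN (by exact_mod_cast Nat.lt_succ_self n)
      simp only [complexity, iInf_lt_iff] at hlt
      obtain ⟨p, hp, hl⟩ := hlt
      have hl' : p.length < n + 1 := by exact_mod_cast hl
      simp only [Set.mem_iUnion]
      exact ⟨p, Nat.lt_succ_iff.mp hl', hp⟩
  exact ⟨Nat.sSup_mem h hfin.bddAbove, fun N hN => le_csSup hfin.bddAbove hN⟩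

/-! Semicomputable sequences of real numbers. -/

/-- A total computable rational-valued function of two natural arguments. -/
def ComputableRat (f : ℕ → ℕ → ℚ) : Prop :=
  ∃ p q r : ℕ → ℕ → ℕ, Computable₂ p ∧ Computable₂ q ∧ Computable₂ r ∧
    ∀ n k : ℕ, f n k = ((p n k : ℚ) - (q n k : ℚ)) / ((r n k : ℚ) + 1)

/-- `a n` is the limit of a total computable rational function `f n k` that is non-decreasing
in `k`. -/
def LowerSemicomputable (a : ℕ → ℝ) : Prop :=
  ∃ f : ℕ → ℕ → ℚ, ComputableRat f ∧ (∀ n, Monotone (f n)) ∧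
    ∀ n, Tendsto (fun k => (f n k : ℝ)) atTop (𝓝 (a n))

/-- `a n` is the limit of a total computable rational function `f n k` that is non-increasing
in `k`. -/
def UpperSemicomputable (a : ℕ → ℝ) : Prop :=
  ∃ f : ℕ → ℕ → ℚ, ComputableRat f ∧ (∀ n, Antitone (f n)) ∧
    ∀ n, Tendsto (fun k => (f n k : ℝ)) atTop (𝓝 (a n))

/-! A priori probability. -/

/-- The terms of a converging lower semicomputable non-negative series. -/
def IsLowerSemicomputableSeries (m : ℕ → ℝ) : Prop :=
  (∀ k, 0 ≤ m k) ∧ Summable m ∧ LowerSemicomputable m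

/-- `m` is an a priori probability: a maximal, up to a multiplicative constant, converging lower
semicomputable non-negative series. -/
def IsAPriori (m : ℕ → ℝ) : Prop :=
  IsLowerSemicomputableSeries m ∧
    ∀ m' : ℕ → ℝ, IsLowerSemicomputableSeries m' → ∃ c : ℝ, ∀ k, m' k ≤ c * m k

/-- The modulus of convergence of the series: the minimal `N` such that the sum of `m k` over all
`k > N` is less than `2 ^ (-n)`. For an a priori probability `m` this is the third busy beaver
function, the one defined through tails. -/
def tailBusyBeaver (m : ℕ → ℝ) (n : ℕ) : ℕ :=
  sInf {N : ℕ | ∑' k : ℕ, m (k + (N + 1)) < (2 : ℝ)⁻¹ ^ n}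

/-- The set in `tailBusyBeaver` is not empty, so that its infimum is a minimum. -/
theorem tailBusyBeaver_spec (m : ℕ → ℝ) (n : ℕ) :
    IsLeast {N : ℕ | ∑' k : ℕ, m (k + (N + 1)) < (2 : ℝ)⁻¹ ^ n} (tailBusyBeaver m n) := by
  have hne : {N : ℕ | ∑' k : ℕ, m (k + (N + 1)) < (2 : ℝ)⁻¹ ^ n}.Nonempty := by
    have h := (tendsto_sum_nat_add m).comp (tendsto_add_atTop_nat 1)
    have hpos : (0 : ℝ) < (2 : ℝ)⁻¹ ^ n := by positivity
    exact (h.eventually (gt_mem_nhds hpos)).exists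
  exact ⟨Nat.sInf_mem hne, fun N hN => Nat.sInf_le hN⟩

end BusyBeaver

end

/-! Both claims are proved by contradiction through one quantity. Replace `x`, `y` by computable
integer approximations `X ≤ x`, `Y ≥ y`. At stage `t`, each `l` receives weight `2^l` times the
largest available `2^(-Y)` with `X ≥ l + c`; in units of `2^(-t)` the total is `capacity`. For fixed
`x` the values of `y` are distinct, so the sum of `2^(-y)` is within a factor 2 of its largest term;
divergence therefore pushes the capacity above any bound, for any shift `c` (`exists_le_capacity`).
A stage with large capacity can be found effectively, and since the approximations are one-sided,
unsettled values are harmless.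

(i) Suppose `B(x n) ≤ BP'(y n)` always. A string `q`, after a short prefix, is a program that waits
until the lower approximation to `S = ∑ m`, shifted by 1, passes the mass already secured by the
strings before `q`. The moment it names is below `B(x n)`, so a tail of at least `2^(-Y)` is still
to come. Thus each string secures its own increment, and together they secure the capacity, which
was chosen to be at least `S + 1`.

(ii) Suppose `BP'(x n) ≤ BP(y n)` always. Play a game against `E`: place `2^t` equal pieces of mass,
each only after enough programs of `E` have appeared. For a pair `(l + c, Y)`, every `2^(t-l)`
consecutive pieces make a tail so heavy that `BP(y n)` is not yet passed, so a new program of length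
at most `Y` must appear. Finally there are `2^l` of them for each such pair, and Kraft's inequality
bounds the capacity by 4 (`capacity_le_of_two_pow_le_card`), although the stage was chosen to give
5. -/

noncomputable section

namespace BusyBeaver

/-! Closure properties of computable functions. -/

section Computability

variable {α : Type*} [Primcodable α]

theorem computable_add {f g : α → ℕ} (hf : Computable f) (hg : Computable g) :
    Computable fun a => f a + g a :=
  Primrec.nat_add.to_comp.comp hf hg

theorem computable_sub {f g : α → ℕ} (hf : Computable f) (hg : Computable g) :
    Computable fun a => f a - g a :=
  Primrec.nat_sub.to_comp.comp hf hg

theorem computable_mul {f g : α → ℕ} (hf : Computable f) (hg : Computable g) :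
    Computable fun a => f a * g a :=
  Primrec.nat_mul.to_comp.comp hf hg

theorem computable_div {f g : α → ℕ} (hf : Computable f) (hg : Computable g) :
    Computable fun a => f a / g a :=
  Primrec.nat_div.to_comp.comp hf hg

theorem computable_two_pow {f : α → ℕ} (hf : Computable f) : Computable fun a => 2 ^ f a := by
  have h : Primrec fun n : ℕ => 2 ^ n :=
    (Primrec.nat_rec₁ 1 ((Primrec.nat_mul.comp₂ Primrec₂.right (Primrec₂.const 2)))).of_eq
      fun n => by induction n with
        | zero => rfl
        | succ n ih => simp only [pow_succ, ← ih]
  exact h.to_comp.comp hf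

theorem computable_decide_le {f g : α → ℕ} (hf : Computable f) (hg : Computable g) :
    Computable fun a => decide (f a ≤ g a) :=
  (Primrec.nat_le.decide).to_comp.comp hf hg

theorem computable_decide_and {p q : α → Prop} [DecidablePred p] [DecidablePred q]
    (hp : Computable fun a => decide (p a)) (hq : Computable fun a => decide (q a)) :
    Computable fun a => decide (p a ∧ q a) :=
  (Primrec.and.to_comp.comp hp hq).of_eq fun a => by simp

theorem computable_decide_not {p : α → Prop} [DecidablePred p]
    (hp : Computable fun a => decide (p a)) : Computable fun a => decide (¬ p a) :=
  (Primrec.not.to_comp.comp hp).of_eq fun a => by simp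

theorem computable_decide_or {p q : α → Prop} [DecidablePred p] [DecidablePred q]
    (hp : Computable fun a => decide (p a)) (hq : Computable fun a => decide (q a)) :
    Computable fun a => decide (p a ∨ q a) :=
  (Primrec.or.to_comp.comp hp hq).of_eq fun a => by simp

theorem computable_ite {σ : Type*} [Primcodable σ] {p : α → Prop} [DecidablePred p] {f g : α → σ}
    (hp : Computable fun a => decide (p a)) (hf : Computable f) (hg : Computable g) :
    Computable fun a => if p a then f a else g a :=
  (Computable.cond hp hf hg).of_eq fun a => by by_cases h : p a <;> simp [h]

theorem computable_sum {n : α → ℕ} {f : α → ℕ → ℕ} (hn : Computable n) (hf : Computable₂ f) :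
    Computable fun a => ∑ i ∈ Finset.range (n a), f a i := by
  have hh : Computable₂ fun (a : α) (p : ℕ × ℕ) => p.2 + f a p.1 :=
    computable_add (Computable.snd.comp Computable.snd)
      (hf.comp Computable.fst (Computable.fst.comp Computable.snd))
  refine (Computable.nat_rec hn (Computable.const 0) hh).of_eq fun a => ?_
  induction n a with
  | zero => rfl
  | succ k ih => rw [Finset.sum_range_succ, ← ih]

theorem computable_sup {n : α → ℕ} {f : α → ℕ → ℕ} (hn : Computable n) (hf : Computable₂ f) :
    Computable fun a => (Finset.range (n a)).sup (f a) := by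
  have hh : Computable₂ fun (a : α) (p : ℕ × ℕ) => max (f a p.1) p.2 :=
    Primrec.nat_max.to_comp.comp (hf.comp Computable.fst (Computable.fst.comp Computable.snd))
      (Computable.snd.comp Computable.snd)
  refine (Computable.nat_rec hn (Computable.const 0) hh).of_eq fun a => ?_
  induction n a with
  | zero => rfl
  | succ k ih => rw [Finset.range_add_one, Finset.sup_insert, ← ih]

theorem computable_decide_forall_lt {n : α → ℕ} {p : α → ℕ → Prop} [∀ a, DecidablePred (p a)]
    (hn : Computable n) (hp : Computable₂ fun a i => decide (p a i)) :
    Computable fun a => decide (∀ i < n a, p a i) := by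
  have h : Computable₂ fun a i => if p a i then 0 else 1 :=
    computable_ite (p := fun b : α × ℕ => p b.1 b.2) hp (Computable.const 0) (Computable.const 1)
  refine (computable_decide_le (computable_sum hn h) (Computable.const 0)).of_eq fun a => ?_
  simp [Finset.sum_eq_zero_iff]

theorem computable_find {p : α → ℕ → Prop} [∀ a, DecidablePred (p a)]
    (hp : Computable₂ fun a i => decide (p a i)) (h : ∀ a, ∃ i, p a i) :
    Computable fun a => Nat.find (h a) := by
  refine (Partrec.rfind hp.partrec₂).of_eq_tot fun a => ?_
  rw [Nat.mem_rfind]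
  refine ⟨?_, fun {i} hi => ?_⟩
  · simpa using Nat.find_spec (h a)
  · simpa using Nat.find_min (h a) hi

end Computability

/-! Integer approximations of semicomputable sequences. -/

/-- The limit is an integer bounding the approximations, so rounding up never overshoots and is
exact once the error is below 1. -/
theorem exists_computable_approx_below {x : ℕ → ℕ}
    (hx : LowerSemicomputable fun n => (x n : ℝ)) :
    ∃ X : ℕ → ℕ → ℕ, Computable₂ X ∧ (∀ n t, X n t ≤ x n) ∧
      ∀ n, ∀ᶠ t in atTop, X n t = x n := by
  obtain ⟨f, ⟨p, q, r, hp, hq, hr, hf⟩, hmono, hlim⟩ := hx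
  have hle : ∀ n t, (f n t : ℝ) ≤ x n := fun n t =>
    Monotone.ge_of_tendsto (fun i j hij => by exact_mod_cast hmono n hij) (hlim n) t
  -- Truncated subtraction is harmless: for `p < q` both sides are 0.
  have key : ∀ n t, (p n t - q n t + r n t) / (r n t + 1) = ⌈f n t⌉₊ := by
    intro n t
    have hr0 : (0 : ℚ) < (r n t : ℚ) + 1 := by positivity
    apply le_antisymm
    · rw [← Nat.lt_succ_iff, Nat.div_lt_iff_lt_mul (by omega)]
      have h1 := Nat.le_ceil (f n t)
      rw [hf, div_le_iff₀ hr0] at h1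
      have h2 : (p n t : ℚ) ≤ q n t + ⌈f n t⌉₊ * (r n t + 1) := by rw [hf]; linarith
      have h3 : p n t ≤ q n t + ⌈f n t⌉₊ * (r n t + 1) := by exact_mod_cast h2
      rw [Nat.succ_eq_add_one, add_mul]
      omega
    · rw [Nat.ceil_le, hf, div_le_iff₀ hr0]
      have h1 := Nat.div_add_mod (p n t - q n t + r n t) (r n t + 1)
      have h2 := Nat.mod_lt (p n t - q n t + r n t) (Nat.succ_pos (r n t))
      set d := (p n t - q n t + r n t) / (r n t + 1)
      have h3 : p n t ≤ q n t + d * (r n t + 1) := by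
        rw [mul_comm d]; simp only [Nat.succ_eq_add_one] at h2; omega
      have h4 : (p n t : ℚ) ≤ q n t + d * (r n t + 1) := by exact_mod_cast h3
      linarith
  refine ⟨fun n t => (p n t - q n t + r n t) / (r n t + 1), ?_, fun n t => ?_, fun n => ?_⟩
  · exact computable_div (computable_add (computable_sub hp hq) hr)
      (computable_add hr (Computable.const 1))
  · simp only [key, Nat.ceil_le]
    exact_mod_cast hle n t
  · have h1 : ∀ᶠ t in atTop, (x n : ℝ) - 1 < f n t := (hlim n).eventually (lt_mem_nhds (by simp))
    filter_upwards [h1] with t ht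
    rw [key]
    apply le_antisymm
    · rw [Nat.ceil_le]; exact_mod_cast hle n t
    · have h2 : (x n : ℝ) < (⌈f n t⌉₊ : ℝ) + 1 := by
        have : ((f n t : ℚ) : ℝ) ≤ ((⌈f n t⌉₊ : ℚ) : ℝ) := by exact_mod_cast Nat.le_ceil (f n t)
        push_cast at this
        linarith
      have h3 : x n < ⌈f n t⌉₊ + 1 := by exact_mod_cast h2
      omega

theorem cast_sub_div_eq_floor (p q r : ℕ) :
    (p - q) / (r + 1) = ⌊((p : ℚ) - q) / (r + 1)⌋₊ := by
  have hr0 : (0 : ℚ) < (r : ℚ) + 1 := by positivity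
  rcases le_total q p with h | h
  · rw [← Nat.cast_sub h, ← Nat.floor_div_eq_div (K := ℚ)]
    push_cast
    rfl
  · rw [Nat.sub_eq_zero_of_le h, Nat.zero_div, eq_comm, Nat.floor_eq_zero]
    refine lt_of_le_of_lt (div_nonpos_of_nonpos_of_nonneg ?_ hr0.le) one_pos
    have : (p : ℚ) ≤ q := by exact_mod_cast h
    linarith

theorem exists_computable_approx_above {y : ℕ → ℕ}
    (hy : UpperSemicomputable fun n => (y n : ℝ)) :
    ∃ Y : ℕ → ℕ → ℕ, Computable₂ Y ∧ (∀ n t, y n ≤ Y n t) ∧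
      ∀ n, ∀ᶠ t in atTop, Y n t = y n := by
  obtain ⟨f, ⟨p, q, r, hp, hq, hr, hf⟩, hmono, hlim⟩ := hy
  have hle : ∀ n t, (y n : ℝ) ≤ f n t := fun n t =>
    Antitone.le_of_tendsto (fun i j hij => by exact_mod_cast hmono n hij) (hlim n) t
  have hle' : ∀ n t, y n ≤ ⌊f n t⌋₊ := fun n t => Nat.le_floor (by exact_mod_cast hle n t)
  have key : ∀ n t, (p n t - q n t) / (r n t + 1) = ⌊f n t⌋₊ := by
    intro n t
    rw [cast_sub_div_eq_floor, hf]
  refine ⟨fun n t => (p n t - q n t) / (r n t + 1), ?_, fun n t => ?_, fun n => ?_⟩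
  · exact computable_div (computable_sub hp hq) (computable_add hr (Computable.const 1))
  · simp only [key]; exact hle' n t
  · have h1 : ∀ᶠ t in atTop, (f n t : ℝ) < y n + 1 := (hlim n).eventually (gt_mem_nhds (by simp))
    filter_upwards [h1] with t ht
    rw [key]
    refine le_antisymm (Nat.lt_succ_iff.mp (Nat.floor_lt' (by simp) |>.mpr ?_)) (hle' n t)
    push_cast
    exact_mod_cast ht

/-- Terms are rounded down to multiples of `2^(-s)`. The bound by the sum over `k < s`, not merely
by the total, leaves room to add the tail beyond `s`. -/
theorem exists_computable_partialSum {m : ℕ → ℝ} (hm : IsLowerSemicomputableSeries m) :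
    ∃ Φ : ℕ → ℕ, Computable Φ ∧ (∀ s, (Φ s : ℝ) / 2 ^ s ≤ ∑ k ∈ Finset.range s, m k) ∧
      ∀ z < ∑' k, m k, ∃ s, z < (Φ s : ℝ) / 2 ^ s := by
  obtain ⟨hnonneg, hsum, f, ⟨p, q, r, hp, hq, hr, hf⟩, hmono, hlim⟩ := hm
  have hle : ∀ n t, (f n t : ℝ) ≤ m n := fun n t =>
    Monotone.ge_of_tendsto (fun i j hij => by exact_mod_cast hmono n hij) (hlim n) t
  let g : ℕ → ℕ → ℕ := fun k s => (2 ^ s * p k s - 2 ^ s * q k s) / (r k s + 1)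
  have hg : ∀ k s, g k s = ⌊2 ^ s * f k s⌋₊ := by
    intro k s
    simp only [g]
    rw [cast_sub_div_eq_floor, hf]
    push_cast
    rw [← mul_sub, mul_div_assoc]
  have hgle : ∀ k s, (g k s : ℝ) / 2 ^ s ≤ m k := by
    intro k s
    rw [div_le_iff₀ (by positivity), hg]
    rcases le_total 0 (f k s) with h | h
    · have h1 : ((⌊2 ^ s * f k s⌋₊ : ℚ) : ℝ) ≤ ((2 ^ s * f k s : ℚ) : ℝ) := by
        exact_mod_cast Nat.floor_le (by positivity)
      push_cast at h1
      nlinarith [hle k s, pow_pos (two_pos : (0 : ℝ) < 2) s]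
    · rw [Nat.floor_of_nonpos (mul_nonpos_of_nonneg_of_nonpos (by positivity) h)]
      simpa using hnonneg k
  have hgge : ∀ k s, (f k s : ℝ) - (2⁻¹ : ℝ) ^ s ≤ (g k s : ℝ) / 2 ^ s := by
    intro k s
    rw [le_div_iff₀ (by positivity), hg, sub_mul, ← mul_pow]
    have h1 : ((2 ^ s * f k s : ℚ) : ℝ) ≤ ((⌊2 ^ s * f k s⌋₊ + 1 : ℚ) : ℝ) := by
      exact_mod_cast (Nat.lt_floor_add_one _).le
    push_cast at h1
    norm_num
    linarith
  have hglim : ∀ k, Tendsto (fun s => (g k s : ℝ) / 2 ^ s) atTop (𝓝 (m k)) := by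
    intro k
    refine tendsto_of_tendsto_of_tendsto_of_le_of_le ?_ tendsto_const_nhds (hgge k) (hgle k)
    simpa using (hlim k).sub
      (tendsto_pow_atTop_nhds_zero_of_lt_one (r := (2⁻¹ : ℝ)) (by norm_num) (by norm_num))
  refine ⟨fun s => ∑ k ∈ Finset.range s, g k s, ?_, fun s => ?_, fun z hz => ?_⟩
  · refine computable_sum Computable.id ?_
    have hp' : Computable fun a : ℕ × ℕ => p a.2 a.1 := hp.comp Computable.snd Computable.fst
    have hq' : Computable fun a : ℕ × ℕ => q a.2 a.1 := hq.comp Computable.snd Computable.fst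
    have hr' : Computable fun a : ℕ × ℕ => r a.2 a.1 := hr.comp Computable.snd Computable.fst
    have h2 : Computable fun a : ℕ × ℕ => 2 ^ a.1 := computable_two_pow Computable.fst
    exact computable_div (computable_sub (computable_mul h2 hp') (computable_mul h2 hq'))
      (computable_add hr' (Computable.const 1))
  · push_cast
    rw [Finset.sum_div]
    exact Finset.sum_le_sum fun k _ => hgle k s
  -- Convergence in `k` is not uniform, so only a fixed head of `M` terms is followed; the other
  -- terms are non-negative.
  · obtain ⟨M, hM⟩ := (hsum.hasSum.tendsto_sum_nat.eventually (lt_mem_nhds hz)).exists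
    have h1 : Tendsto (fun s => ∑ k ∈ Finset.range M, (g k s : ℝ) / 2 ^ s) atTop
        (𝓝 (∑ k ∈ Finset.range M, m k)) := tendsto_finsetSum _ fun k _ => hglim k
    obtain ⟨s, hs, hMs⟩ := ((h1.eventually (lt_mem_nhds hM)).and (eventually_ge_atTop M)).exists
    refine ⟨s, hs.trans_le ?_⟩
    push_cast
    rw [Finset.sum_div]
    exact Finset.sum_le_sum_of_subset_of_nonneg (by simpa using hMs) fun _ _ _ => by positivity

/-! The capacity of a family of pairs. -/

/-- The largest `2 ^ (t - Y n t)` over the indices `n < t` with `c ≤ X n t`. -/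
def increment (X Y : ℕ → ℕ → ℕ) (c t : ℕ) : ℕ :=
  (Finset.range t).sup fun n => if c ≤ X n t ∧ Y n t ≤ t then 2 ^ (t - Y n t) else 0

/-- An approximation, in units of `2 ^ (-t)`, to the sum of `2 ^ (x - y - c)` over pairs `(x, y)`
with different first coordinates `x ≥ c`. -/
def capacity (X Y : ℕ → ℕ → ℕ) (c t : ℕ) : ℕ :=
  ∑ l ∈ Finset.range t, 2 ^ l * increment X Y (l + c) t

theorem le_increment {X Y : ℕ → ℕ → ℕ} {c t n : ℕ} (hn : n < t) (hc : c ≤ X n t)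
    (hY : Y n t ≤ t) : 2 ^ (t - Y n t) ≤ increment X Y c t := by
  have h := Finset.le_sup (f := fun n => if c ≤ X n t ∧ Y n t ≤ t then 2 ^ (t - Y n t) else 0)
    (Finset.mem_range.mpr hn)
  simpa [hc, hY, increment] using h

theorem increment_eq_zero_or (X Y : ℕ → ℕ → ℕ) (c t : ℕ) :
    increment X Y c t = 0 ∨
      ∃ n < t, c ≤ X n t ∧ Y n t ≤ t ∧ increment X Y c t = 2 ^ (t - Y n t) := by
  rcases t.eq_zero_or_pos with rfl | ht
  · simp [increment]
  · obtain ⟨n, hn, h⟩ := Finset.exists_mem_eq_sup (Finset.range t) ⟨0, by simpa using ht⟩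
      fun n => if c ≤ X n t ∧ Y n t ≤ t then 2 ^ (t - Y n t) else 0
    change increment X Y c t = _ at h
    split_ifs at h with hc
    · exact Or.inr ⟨n, Finset.mem_range.mp hn, hc.1, hc.2, h⟩
    · exact Or.inl h

theorem computable_increment {X Y : ℕ → ℕ → ℕ} (hX : Computable₂ X) (hY : Computable₂ Y) :
    Computable₂ (increment X Y) := by
  refine computable_sup (α := ℕ × ℕ) (n := fun a => a.2)
    (f := fun a n => if a.1 ≤ X n a.2 ∧ Y n a.2 ≤ a.2 then 2 ^ (a.2 - Y n a.2) else 0)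
    Computable.snd ?_
  have hc : Computable fun b : (ℕ × ℕ) × ℕ => b.1.1 := Computable.fst.comp Computable.fst
  have ht : Computable fun b : (ℕ × ℕ) × ℕ => b.1.2 := Computable.snd.comp Computable.fst
  have hXb : Computable fun b : (ℕ × ℕ) × ℕ => X b.2 b.1.2 := hX.comp Computable.snd ht
  have hYb : Computable fun b : (ℕ × ℕ) × ℕ => Y b.2 b.1.2 := hY.comp Computable.snd ht
  exact computable_ite (p := fun b : (ℕ × ℕ) × ℕ => b.1.1 ≤ X b.2 b.1.2 ∧ Y b.2 b.1.2 ≤ b.1.2)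
    (computable_decide_and (computable_decide_le hc hXb) (computable_decide_le hYb ht))
    (computable_two_pow (computable_sub ht hYb)) (Computable.const 0)

theorem computable_capacity {X Y : ℕ → ℕ → ℕ} (hX : Computable₂ X) (hY : Computable₂ Y) :
    Computable₂ (capacity X Y) := by
  refine computable_sum (α := ℕ × ℕ) (n := fun a => a.2)
    (f := fun a l => 2 ^ l * increment X Y (l + a.1) a.2) Computable.snd ?_
  exact computable_mul (computable_two_pow Computable.snd)
    ((computable_increment hX hY).comp
      (computable_add Computable.snd (Computable.fst.comp Computable.fst))
      (Computable.snd.comp Computable.fst))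

theorem sum_half_pow_le {ι : Type*} (F : Finset ι) (y : ι → ℕ) (hy : Set.InjOn y F) (b : ℕ)
    (hb : ∀ n ∈ F, b ≤ y n) : ∑ n ∈ F, (2⁻¹ : ℝ) ^ y n ≤ 2 * 2⁻¹ ^ b := by
  have h1 : ∑ n ∈ F, (2⁻¹ : ℝ) ^ y n = (∑ k ∈ F.image fun n => y n - b, (2⁻¹ : ℝ) ^ k) * 2⁻¹ ^ b := by
    rw [Finset.sum_image, Finset.sum_mul]
    · exact Finset.sum_congr rfl fun n hn => by rw [← pow_add, Nat.sub_add_cancel (hb n hn)]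
    · intro n hn k hk h
      have hn' := hb n hn
      have hk' := hb k hk
      exact hy hn hk (by simp only at h; omega)
  rw [h1]
  refine mul_le_mul_of_nonneg_right ?_ (by positivity)
  have h2 : HasSum (fun k : ℕ => (2⁻¹ : ℝ) ^ k) 2 := by
    simpa using hasSum_geometric_two
  exact sum_le_hasSum _ (fun _ _ => by positivity) h2

/-- Group the divergent sum by the value of `x`; each group is at most twice its term with the
smallest `y`, which `increment` records. -/
theorem exists_le_capacity {x y : ℕ → ℕ} {X Y : ℕ → ℕ → ℕ}
    (hdistinct : Function.Injective fun n : ℕ => (x n, y n)) (hxy : ∀ n, x n ≤ y n)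
    (hX : ∀ n, ∀ᶠ t in atTop, X n t = x n) (hY : ∀ n, ∀ᶠ t in atTop, Y n t = y n)
    (hdiv : ¬ Summable fun n : ℕ => (2 : ℝ) ^ ((x n : ℤ) - (y n : ℤ))) (c K : ℕ) :
    ∃ t, K * 2 ^ t ≤ capacity X Y c t := by
  by_contra! hK
  -- Each of the groups `x n < c` contributes at most 2; the groups `x n = c + l` together
  -- contribute at most `2 * 2^c` times the normalized capacity.
  refine hdiv (summable_of_sum_le (c := 2 * c + 2 ^ (c + 1) * K) (fun n => by positivity)
    fun F => ?_)
  obtain ⟨t, ht⟩ : ∃ t, ∀ n ∈ F, X n t = x n ∧ Y n t = y n ∧ n < t ∧ y n < t :=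
    ((F.eventually_all).mpr fun n _ => (hX n).and ((hY n).and ((eventually_gt_atTop n).and
      (eventually_gt_atTop (y n))))).exists
  have hfib : ∑ n ∈ F, (2 : ℝ) ^ ((x n : ℤ) - (y n : ℤ)) =
      ∑ z ∈ Finset.range (c + t), 2 ^ z * ∑ n ∈ F with x n = z, (2⁻¹ : ℝ) ^ y n := by
    rw [← Finset.sum_fiberwise_of_maps_to (g := x) (t := Finset.range (c + t))]
    · refine Finset.sum_congr rfl fun z _ => ?_
      rw [Finset.mul_sum]
      refine Finset.sum_congr rfl fun n hn => ?_
      rw [(Finset.mem_filter.mp hn).2, zpow_sub₀ two_ne_zero, zpow_natCast, zpow_natCast, inv_pow,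
        div_eq_mul_inv]
    · intro n hn
      have := hxy n
      have := (ht n hn).2.2.2
      simp only [Finset.mem_range]
      omega
  have hle : ∀ z b, (∀ n ∈ F, x n = z → b ≤ y n) →
      ∑ n ∈ F with x n = z, (2⁻¹ : ℝ) ^ y n ≤ 2 * 2⁻¹ ^ b := by
    intro z b hb
    refine sum_half_pow_le _ y ?_ b ?_
    · intro n hn k hk h
      simp only [Finset.coe_filter, Set.mem_ofPred_eq] at hn hk
      exact hdistinct (Prod.ext (hn.2.trans hk.2.symm) h)
    · intro n hn
      exact hb n (Finset.mem_filter.mp hn).1 (Finset.mem_filter.mp hn).2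
  have hsmall : ∀ z, 2 ^ z * ∑ n ∈ F with x n = z, (2⁻¹ : ℝ) ^ y n ≤ 2 := by
    intro z
    have h := hle z z fun n _ hn => hn ▸ hxy n
    calc (2 : ℝ) ^ z * ∑ n ∈ F with x n = z, (2⁻¹ : ℝ) ^ y n ≤ 2 ^ z * (2 * 2⁻¹ ^ z) := by gcongr
      _ = 2 := by rw [inv_pow]; field_simp
  have hlarge : ∀ z, ∑ n ∈ F with x n = z, (2⁻¹ : ℝ) ^ y n ≤ 2 * (increment X Y z t / 2 ^ t) := by
    intro z
    rcases (F.filter fun n => x n = z).eq_empty_or_nonempty with h | h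
    · rw [h, Finset.sum_empty]; positivity
    · obtain ⟨k, hk, hmin⟩ := Finset.exists_min_image _ y h
      simp only [Finset.mem_filter] at hk hmin
      obtain ⟨h1, h2, h3, h4⟩ := ht k hk.1
      refine (hle z (y k) fun n hn hz => hmin n ⟨hn, hz⟩).trans ?_
      have h5 : 2 ^ (t - Y k t) ≤ increment X Y z t :=
        le_increment h3 (by omega) (by omega)
      have h6 : (2 : ℝ) ^ (t - y k) ≤ increment X Y z t := by rw [h2] at h5; exact_mod_cast h5
      gcongr
      rw [le_div_iff₀ (by positivity)]
      refine le_trans (le_of_eq ?_) h6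
      rw [pow_sub₀ _ two_ne_zero h4.le, inv_pow, mul_comm]
  rw [hfib, Finset.sum_range_add]
  refine add_le_add ?_ ?_
  · refine (Finset.sum_le_sum fun z _ => hsmall z).trans (le_of_eq ?_)
    simp [mul_comm]
  · calc ∑ l ∈ Finset.range t, (2 : ℝ) ^ (c + l) * ∑ n ∈ F with x n = c + l, (2⁻¹ : ℝ) ^ y n
        ≤ ∑ l ∈ Finset.range t, (2 : ℝ) ^ (c + l) * (2 * ((increment X Y (c + l) t : ℝ) / 2 ^ t)) :=
          Finset.sum_le_sum fun l _ => by gcongr; exact hlarge _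
      _ = 2 ^ (c + 1) * ((capacity X Y c t : ℝ) / 2 ^ t) := by
          simp only [capacity]
          push_cast
          rw [Finset.sum_div, Finset.mul_sum]
          refine Finset.sum_congr rfl fun l _ => ?_
          rw [add_comm l c]
          ring
      _ ≤ 2 ^ (c + 1) * K := by
          gcongr
          rw [div_le_iff₀ (by positivity)]
          exact_mod_cast (hK t).le

theorem exists_computable_stage {X Y : ℕ → ℕ → ℕ} (hX : Computable₂ X) (hY : Computable₂ Y)
    (h : ∀ c K, ∃ t, K * 2 ^ t ≤ capacity X Y c t) :
    ∃ τ : ℕ → ℕ → ℕ, Computable₂ τ ∧ ∀ c K, K * 2 ^ τ c K ≤ capacity X Y c (τ c K) := by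
  refine ⟨fun c K => Nat.find (h c K), ?_, fun c K => Nat.find_spec (h c K)⟩
  refine computable_find (α := ℕ × ℕ) (p := fun a t => a.2 * 2 ^ t ≤ capacity X Y a.1 t) ?_
    fun a => h a.1 a.2
  exact computable_decide_le (computable_mul (Computable.snd.comp Computable.fst)
    (computable_two_pow Computable.snd))
    ((computable_capacity hX hY).comp (Computable.fst.comp Computable.fst) Computable.snd)

/-! Basic facts on complexity and on tails. -/

theorem complexity_le_length {D : Decompressor} {p : List Bool} {N : ℕ} (h : N ∈ D p) :
    complexity D N ≤ p.length :=
  iInf₂_le p h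

theorem exists_program_of_complexity_le {D : Decompressor} {n N : ℕ} (h : complexity D N ≤ n) :
    ∃ p, N ∈ D p ∧ p.length ≤ n := by
  have hlt : complexity D N < ((n + 1 : ℕ) : ℕ∞) :=
    lt_of_le_of_lt h (by exact_mod_cast Nat.lt_succ_self n)
  simp only [complexity, iInf_lt_iff] at hlt
  obtain ⟨p, hp, hl⟩ := hlt
  exact ⟨p, hp, Nat.lt_succ_iff.mp (by exact_mod_cast hl)⟩

theorem le_busyBeaver {D : Decompressor} {n N : ℕ} (h : complexity D N ≤ n) :
    N ≤ busyBeaver D n :=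
  (isGreatest_busyBeaver D n ⟨N, h⟩).2 h

theorem le_tsum_of_lt_tailBusyBeaver {m : ℕ → ℝ} {n N : ℕ} (h : N < tailBusyBeaver m n) :
    (2⁻¹ : ℝ) ^ n ≤ ∑' k, m (k + (N + 1)) :=
  not_lt.mp (Nat.notMem_of_lt_sInf h)

/-- Here the tail starts at `N` itself: a smaller value of the function would give a tail starting
at or before `N`, hence at least as large. -/
theorem le_tailBusyBeaver {m : ℕ → ℝ} (hm : ∀ k, 0 ≤ m k) (hs : Summable m) {n N : ℕ}
    (h : (2⁻¹ : ℝ) ^ n ≤ ∑' k, m (k + N)) : N ≤ tailBusyBeaver m n := by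
  by_contra! hlt
  have h1 := (tailBusyBeaver_spec m n).1
  simp only [Set.mem_ofPred_eq] at h1
  refine (h.trans_lt' h1).not_ge ?_
  obtain ⟨d, rfl⟩ := Nat.exists_eq_add_of_lt hlt
  have h2 : Summable fun k => m (k + (tailBusyBeaver m n + 1)) := (summable_nat_add_iff _).mpr hs
  rw [← h2.sum_add_tsum_nat_add d]
  refine le_trans (le_of_eq (tsum_congr fun k => ?_))
    (le_add_of_nonneg_left (Finset.sum_nonneg fun _ _ => hm _))
  congr 1
  omega

/-! The plain busy beaver function against the tail busy beaver function. -/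

/-- The number whose binary digits, the least significant one first, form the given string. -/
def bitsToNat (q : List Bool) : ℕ := q.foldr (fun b n => 2 * n + b.toNat) 0

theorem exists_bitsToNat_eq (l j : ℕ) (hj : j < 2 ^ l) :
    ∃ q : List Bool, q.length = l ∧ bitsToNat q = j := by
  induction l generalizing j with
  | zero => exact ⟨[], rfl, by simp only [pow_zero] at hj; simp [bitsToNat]; omega⟩
  | succ l ih =>
    obtain ⟨q, hq, hqj⟩ := ih (j / 2) (by rw [pow_succ] at hj; omega)
    refine ⟨decide (j % 2 = 1) :: q, by simp [hq], ?_⟩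
    have h : bitsToNat (decide (j % 2 = 1) :: q) = 2 * bitsToNat q + (decide (j % 2 = 1)).toNat := rfl
    rw [h, hqj]
    rcases Nat.mod_two_eq_zero_or_one j with h | h <;> simp [h] <;> omega

theorem computable_bitsToNat : Computable bitsToNat := by
  have h : Primrec₂ fun (_ : List Bool) (p : Bool × ℕ) => 2 * p.2 + p.1.toNat :=
    Primrec.nat_add.comp₂ ((Primrec.nat_double.comp (Primrec.snd.comp Primrec.snd)))
      ((Primrec.dom_bool Bool.toNat).comp (Primrec.fst.comp Primrec.snd))
  exact (Primrec.list_foldr Primrec.id (Primrec.const 0) h).to_comp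

/-- Splits `1 ^ a 0 q` into `a` and `q`. -/
def splitUnary (p : List Bool) : ℕ × List Bool :=
  ((p.takeWhile id).length, (p.dropWhile id).tail)

theorem splitUnary_append (a : ℕ) (q : List Bool) :
    splitUnary (List.replicate a true ++ false :: q) = (a, q) := by
  simp [splitUnary, List.takeWhile_append_of_pos, List.dropWhile_append_of_pos]

theorem computable_splitUnary : Computable splitUnary :=
  (Primrec.pair (Primrec.list_length.comp (Primrec.list_takeWhile Primrec.id))
    (Primrec.list_tail.comp (Primrec.list_dropWhile Primrec.id))).to_comp

/-- The sum, in units of `2 ^ (-t)`, of the increments allotted to the strings preceding `q`. -/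
def threshold (X Y : ℕ → ℕ → ℕ) (c t : ℕ) (q : List Bool) : ℕ :=
  ∑ l ∈ Finset.range q.length, 2 ^ l * increment X Y (l + c) t +
    bitsToNat q * increment X Y (q.length + c) t

/-- The test whether the `s`-th approximation `Φ s / 2 ^ s`, increased by one, exceeds the
threshold of the program `p`. -/
def ExceedsThreshold (X Y τ : ℕ → ℕ → ℕ) (Φ : ℕ → ℕ) (p : List Bool) (s : ℕ) : Prop :=
  threshold X Y (2 * (splitUnary p).1 + 1) (τ (2 * (splitUnary p).1 + 1) (splitUnary p).1)
    (splitUnary p).2 * 2 ^ s + 1 ≤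
    (Φ s + 2 ^ s) * 2 ^ τ (2 * (splitUnary p).1 + 1) (splitUnary p).1

instance (X Y τ : ℕ → ℕ → ℕ) (Φ : ℕ → ℕ) (p : List Bool) (s : ℕ) :
    Decidable (ExceedsThreshold X Y τ Φ p s) := by
  unfold ExceedsThreshold
  infer_instance

/-- The decompressor that waits until the threshold of the program is exceeded. -/
def thresholdDecompressor (X Y τ : ℕ → ℕ → ℕ) (Φ : ℕ → ℕ) : Decompressor := fun p =>
  (Nat.rfind fun s => Part.some (decide (ExceedsThreshold X Y τ Φ p s))).map Nat.succ

theorem partrec_thresholdDecompressor {X Y τ : ℕ → ℕ → ℕ} {Φ : ℕ → ℕ} (hX : Computable₂ X)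
    (hY : Computable₂ Y) (hτ : Computable₂ τ) (hΦ : Computable Φ) :
    Partrec (thresholdDecompressor X Y τ Φ) := by
  have ha : Computable fun b : List Bool × ℕ => (splitUnary b.1).1 :=
    Computable.fst.comp (computable_splitUnary.comp Computable.fst)
  have hq : Computable fun b : List Bool × ℕ => (splitUnary b.1).2 :=
    Computable.snd.comp (computable_splitUnary.comp Computable.fst)
  have hc : Computable fun b : List Bool × ℕ => 2 * (splitUnary b.1).1 + 1 :=
    computable_add (computable_mul (Computable.const 2) ha) (Computable.const 1)
  have ht : Computable fun b : List Bool × ℕ =>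
      τ (2 * (splitUnary b.1).1 + 1) (splitUnary b.1).1 := hτ.comp hc ha
  have hl := Computable.list_length.comp hq
  have hT : Computable fun b : List Bool × ℕ => threshold X Y (2 * (splitUnary b.1).1 + 1)
      (τ (2 * (splitUnary b.1).1 + 1) (splitUnary b.1).1) (splitUnary b.1).2 := by
    refine computable_add (computable_sum hl ?_) (computable_mul (computable_bitsToNat.comp hq)
      ((computable_increment hX hY).comp (computable_add hl hc) ht))
    exact computable_mul (computable_two_pow Computable.snd) ((computable_increment hX hY).comp
      (computable_add Computable.snd (hc.comp Computable.fst)) (ht.comp Computable.fst))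
  have hs : Computable fun b : List Bool × ℕ => 2 ^ b.2 := computable_two_pow Computable.snd
  have hdec : Computable₂ fun p s => decide (ExceedsThreshold X Y τ Φ p s) :=
    computable_decide_le (computable_add (computable_mul hT hs) (Computable.const 1))
      (computable_mul (computable_add (hΦ.comp Computable.snd) hs) (computable_two_pow ht))
  exact (Partrec.rfind hdec.partrec₂).map (Computable.succ.comp Computable.snd)

theorem exists_tailBusyBeaver_lt_busyBeaver {D : Decompressor} (hD : IsOptimal D) {m : ℕ → ℝ}
    (hm : IsLowerSemicomputableSeries m) {x y : ℕ → ℕ} {X Y : ℕ → ℕ → ℕ} (hX : Computable₂ X)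
    (hY : Computable₂ Y) (hXx : ∀ n t, X n t ≤ x n) (hyY : ∀ n t, y n ≤ Y n t)
    (hcap : ∀ c K, ∃ t, K * 2 ^ t ≤ capacity X Y c t) :
    ∃ n, busyBeaver D (x n) > tailBusyBeaver m (y n) := by
  by_contra! hcon
  obtain ⟨τ, hτ, hτcap⟩ := exists_computable_stage hX hY hcap
  obtain ⟨Φ, hΦ, hΦle, hΦlim⟩ := exists_computable_partialSum hm
  obtain ⟨c₀, hc₀⟩ := hD.2 _ (partrec_thresholdDecompressor hX hY hτ hΦ)
  set S := ∑' k, m k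
  -- One number plays two roles: it pays for the optimality constant `c₀` and is the capacity target
  -- `K`. The program carries only `a` and recomputes `c` and `t`.
  obtain ⟨a, ha⟩ := exists_nat_ge (max (c₀ : ℝ) (S + 1))
  have hac : c₀ ≤ a := by exact_mod_cast (le_max_left _ _).trans ha
  have haS : S + 1 ≤ a := (le_max_right _ _).trans ha
  -- The prefix `1^a 0` costs `a + 1` bits, the passage to `D` at most `a` more.
  set c := 2 * a + 1 with hc
  set t := τ c a with ht
  have hΦS : ∀ s, (Φ s : ℝ) / 2 ^ s ≤ S := fun s =>
    (hΦle s).trans (hm.2.1.sum_le_tsum _ fun _ _ => hm.1 _)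
  -- If the mass secured before `q` lies below `S + 1`, the program of `q` halts, and the tail after
  -- its moment keeps the sum below `S + 1` with the increment of `q` added.
  have hstep : ∀ q : List Bool, (threshold X Y c t q : ℝ) < (S + 1) * 2 ^ t →
      (threshold X Y c t q + increment X Y (q.length + c) t : ℝ) < (S + 1) * 2 ^ t := by
    intro q hq
    rcases increment_eq_zero_or X Y (q.length + c) t with h0 | ⟨n, hn, hcn, hYt, hinc⟩
    · simpa [h0] using hq
    · set p : List Bool := List.replicate a true ++ false :: q
      have hsplit : splitUnary p = (a, q) := splitUnary_append a q
      have hex : ∀ s, ExceedsThreshold X Y τ Φ p s ↔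
          (threshold X Y c t q : ℝ) < ((Φ s : ℝ) / 2 ^ s + 1) * 2 ^ t := by
        intro s
        rw [ExceedsThreshold, hsplit, Nat.succ_le_iff, ← Nat.cast_lt (α := ℝ)]
        push_cast
        have h2 : ((Φ s : ℝ) / 2 ^ s + 1) * 2 ^ t = (Φ s + 2 ^ s) * 2 ^ t / 2 ^ s := by
          field_simp
        rw [h2, lt_div_iff₀ (by positivity)]
      obtain ⟨s₀, hs₀⟩ : ∃ s, ExceedsThreshold X Y τ Φ p s := by
        have h1 : (threshold X Y c t q : ℝ) / 2 ^ t - 1 < S := by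
          rw [sub_lt_iff_lt_add, div_lt_iff₀ (by positivity)]; exact hq
        obtain ⟨s, hs⟩ := hΦlim _ h1
        refine ⟨s, (hex s).mpr ?_⟩
        rwa [sub_lt_iff_lt_add, div_lt_iff₀ (by positivity)] at hs
      obtain ⟨s, hs, -⟩ := Nat.rfind_min' (p := fun s => decide (ExceedsThreshold X Y τ Φ p s))
        (m := s₀) (by simpa using hs₀)
      -- The output is `s + 1` so that `s` lies strictly below the busy beaver value and the tail
      -- over `k > s` is large.
      have hmem : s + 1 ∈ thresholdDecompressor X Y τ Φ p := Part.mem_map Nat.succ hs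
      have hexs : ExceedsThreshold X Y τ Φ p s := by
        have := Nat.rfind_spec hs
        simpa using this
      have hcomp : complexity D (s + 1) ≤ x n := by
        refine (hc₀ (s + 1)).trans ((add_le_add_left (complexity_le_length hmem) _).trans ?_)
        have hlen : p.length = a + (q.length + 1) := by simp [p]
        have := hXx n t
        rw [hlen]
        norm_cast
        omega
      have htail := le_tsum_of_lt_tailBusyBeaver
        ((Nat.succ_le_iff.mp (le_busyBeaver hcomp)).trans_le (hcon n))
      have hsumS : ∑ k ∈ Finset.range (s + 1), m k + ∑' k, m (k + (s + 1)) = S :=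
        hm.2.1.sum_add_tsum_nat_add (s + 1)
      have h3 : (Φ s : ℝ) / 2 ^ s + 2⁻¹ ^ Y n t ≤ S := by
        rw [← hsumS, Finset.sum_range_succ]
        have h4 : (2⁻¹ : ℝ) ^ Y n t ≤ 2⁻¹ ^ y n :=
          pow_le_pow_of_le_one (by norm_num) (by norm_num) (hyY n t)
        linarith [hΦle s, hm.1 s]
      have h5 : (increment X Y (q.length + c) t : ℝ) = 2⁻¹ ^ Y n t * 2 ^ t := by
        rw [hinc]
        push_cast
        rw [pow_sub₀ _ two_ne_zero hYt, inv_pow, mul_comm]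
      rw [h5]
      have h6 := (hex s).mp hexs
      have h7 : (0 : ℝ) < 2 ^ t := by positivity
      nlinarith
  -- Strings are taken by length, then by binary value: `j` runs over those of length `l`.
  have hblock : ∀ l, (∑ z ∈ Finset.range l, 2 ^ z * increment X Y (z + c) t : ℕ) <
      (S + 1) * 2 ^ t := by
    intro l
    induction l with
    | zero =>
      -- The shift by 1 starts the induction even when `S = 0`.
      have : 0 ≤ S := tsum_nonneg hm.1
      simp only [Finset.range_zero, Finset.sum_empty, Nat.cast_zero]
      positivity
    | succ l ih =>
      have hin : ∀ j ≤ 2 ^ l, ((∑ z ∈ Finset.range l, 2 ^ z * increment X Y (z + c) t +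
          j * increment X Y (l + c) t : ℕ) : ℝ) < (S + 1) * 2 ^ t := by
        intro j
        induction j with
        | zero => intro _; simpa using ih
        | succ j ihj =>
          intro hj
          obtain ⟨q, hq, hqj⟩ := exists_bitsToNat_eq l j hj
          have h := hstep q (by simpa only [threshold, hq, hqj] using ihj (by omega))
          rw [threshold, hq, hqj] at h
          refine lt_of_eq_of_lt ?_ h
          push_cast
          ring
      rw [Finset.sum_range_succ]
      exact hin _ le_rfl
  have h1 := hblock t
  have h2 : ((a * 2 ^ t : ℕ) : ℝ) ≤ (capacity X Y c t : ℕ) := by exact_mod_cast hτcap c a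
  rw [capacity] at h2
  push_cast at h1 h2
  have h3 : (S + 1) * 2 ^ t ≤ a * 2 ^ t := by gcongr
  linarith

/-! Counting the programs of a prefix-free decompressor. -/

/-- Kraft's inequality from McMillan's: a prefix-free set is uniquely decodable unless it contains
the empty word, in which case it contains nothing else. -/
theorem sum_half_pow_length_le_one (S : Finset (List Bool))
    (hS : ∀ p ∈ S, ∀ q ∈ S, p <+: q → p = q) : ∑ p ∈ S, (2⁻¹ : ℝ) ^ p.length ≤ 1 := by
  by_cases hnil : [] ∈ S
  · have h : S = {[]} := by
      ext p
      rw [Finset.mem_singleton]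
      exact ⟨fun hp => (hS _ hnil _ hp List.nil_prefix).symm, fun hp => hp ▸ hnil⟩
    simp [h]
  · have hdec : InformationTheory.UniquelyDecodable (S : Set (List Bool)) := by
      intro L₁
      induction L₁ with
      | nil =>
        rintro (_ | ⟨w, L₂⟩) - h₂ h
        · rfl
        · simp only [List.flatten_nil, List.flatten_cons, List.nil_eq, List.append_eq_nil_iff] at h
          exact absurd (h₂ w (by simp)) (by simpa [h.1] using hnil)
      | cons v L₁ ih =>
        rintro (_ | ⟨w, L₂⟩) h₁ h₂ h
        · simp only [List.flatten_nil, List.flatten_cons, List.append_eq_nil_iff] at h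
          exact absurd (h₁ v (by simp)) (by simpa [h.1] using hnil)
        · simp only [List.flatten_cons] at h
          have hv : v ∈ S := h₁ v (by simp)
          have hw : w ∈ S := h₂ w (by simp)
          have hvw : v = w := by
            rcases List.prefix_or_prefix_of_prefix (List.prefix_append v L₁.flatten)
              (h ▸ List.prefix_append w L₂.flatten) with h' | h'
            · exact hS v hv w hw h'
            · exact (hS w hw v hv h').symm
          subst hvw
          rw [ih L₂ (fun u hu => h₁ u (by simp [hu])) (fun u hu => h₂ u (by simp [hu]))
            (List.append_cancel_left h)]
    simpa using InformationTheory.kraft_mcmillan_inequality hdec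

/-- The length of the program with a given number. -/
def programLength (i : ℕ) : ℕ := ((Encodable.decode i : Option (List Bool)).getD []).length

/-- The numbers of the programs of length at most `y` that are found, within `s` steps, to produce
a value below `s`. -/
def foundPrograms (code : Nat.Partrec.Code) (y s : ℕ) : Finset ℕ :=
  (Finset.range s).filter fun i => (code.evaln s i).getD s + 1 ≤ s ∧ programLength i ≤ y

/-- The default `s` in `getD` fails the test, so unfinished runs are rejected; `i < s` is automatic
for finished ones. -/
theorem mem_foundPrograms {code : Nat.Partrec.Code} {y s i : ℕ} :
    i ∈ foundPrograms code y s ↔ (∃ v ∈ code.evaln s i, v < s) ∧ programLength i ≤ y := by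
  rw [foundPrograms, Finset.mem_filter, Finset.mem_range]
  constructor
  · rintro ⟨-, h, hl⟩
    refine ⟨?_, hl⟩
    rcases hv : code.evaln s i with _ | v
    · simp [hv] at h
    · exact ⟨v, rfl, by simpa [hv, Nat.succ_le_iff] using h⟩
  · rintro ⟨⟨v, hv, hvs⟩, hl⟩
    refine ⟨Nat.Partrec.Code.evaln_bound hv, ?_, hl⟩
    rw [Option.mem_def.mp hv]
    exact hvs

theorem foundPrograms_mono (code : Nat.Partrec.Code) (y : ℕ) : Monotone (foundPrograms code y) := by
  intro s s' hs i hi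
  rw [mem_foundPrograms] at hi ⊢
  obtain ⟨⟨v, hv, hvs⟩, hl⟩ := hi
  exact ⟨⟨v, Nat.Partrec.Code.evaln_mono hs hv, hvs.trans_le hs⟩, hl⟩

theorem computable_card_foundPrograms (code : Nat.Partrec.Code) :
    Computable₂ fun y s => (foundPrograms code y s).card := by
  have hs : Computable fun b : (ℕ × ℕ) × ℕ => b.1.2 := Computable.snd.comp Computable.fst
  have hev : Computable fun b : (ℕ × ℕ) × ℕ => code.evaln b.1.2 b.2 :=
    Nat.Partrec.Code.primrec_evaln.to_comp.comp
      (Computable.pair (Computable.pair hs (Computable.const code)) Computable.snd)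
  have hlen : Computable fun b : (ℕ × ℕ) × ℕ => programLength b.2 :=
    Computable.list_length.comp (Computable.option_getD (Computable.decode.comp Computable.snd)
      (Computable.const []))
  have htest := computable_decide_and
    (computable_decide_le (computable_add (Computable.option_getD hev hs) (Computable.const 1)) hs)
    (computable_decide_le hlen (Computable.fst.comp Computable.fst))
  refine (computable_sum (α := ℕ × ℕ) (n := fun a => a.2) (f := fun a i =>
    if (code.evaln a.2 i).getD a.2 + 1 ≤ a.2 ∧ programLength i ≤ a.1 then 1 else 0)
    Computable.snd ?_).of_eq fun a => (Finset.card_filter _ _).symm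
  exact computable_ite (p := fun b : (ℕ × ℕ) × ℕ =>
    (code.evaln b.1.2 b.2).getD b.1.2 + 1 ≤ b.1.2 ∧ programLength b.2 ≤ b.1.1)
    htest (Computable.const 1) (Computable.const 0)

/-- The code computes the decompressor on numbers of programs. -/
def IsCodeOf (code : Nat.Partrec.Code) (E : Decompressor) : Prop :=
  ∀ i v : ℕ, v ∈ code.eval i ↔ ∃ p : List Bool, Encodable.encode p = i ∧ v ∈ E p

theorem exists_isCodeOf {E : Decompressor} (hE : Partrec E) : ∃ code, IsCodeOf code E := by
  obtain ⟨code, hcode⟩ := Nat.Partrec.Code.exists_code.mp (Partrec.bind_decode₂_iff.mp hE)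
  refine ⟨code, fun i v => ?_⟩
  rw [hcode, Part.mem_bind_iff]
  simp [Encodable.decode₂_eq_some]

theorem exists_program_of_mem_foundPrograms {code : Nat.Partrec.Code} {E : Decompressor}
    (hcode : IsCodeOf code E) {y s i : ℕ} (hi : i ∈ foundPrograms code y s) :
    ∃ p : List Bool, Encodable.encode p = i ∧ (E p).Dom ∧ p.length = programLength i := by
  obtain ⟨⟨v, hv, -⟩, -⟩ := mem_foundPrograms.mp hi
  obtain ⟨p, rfl, hp⟩ := (hcode i v).mp (Nat.Partrec.Code.evaln_sound hv)
  exact ⟨p, rfl, Part.dom_iff_mem.mpr ⟨v, hp⟩, by simp [programLength]⟩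

theorem sum_half_pow_programLength_le_one {code : Nat.Partrec.Code} {E : Decompressor}
    (hcode : IsCodeOf code E) (hE : PrefixFree E) (y s : ℕ) :
    ∑ i ∈ foundPrograms code y s, (2⁻¹ : ℝ) ^ programLength i ≤ 1 := by
  choose! p hp using fun i (hi : i ∈ foundPrograms code y s) =>
    exists_program_of_mem_foundPrograms hcode hi
  have hinj : Set.InjOn p (foundPrograms code y s) := fun i hi j hj h => by
    rw [← (hp i hi).1, ← (hp j hj).1, h]
  have h := sum_half_pow_length_le_one ((foundPrograms code y s).image p) ?_
  · rw [Finset.sum_image hinj] at h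
    refine le_of_eq_of_le (Finset.sum_congr rfl fun i hi => ?_) h
    rw [(hp i hi).2.2]
  · intro u hu v hv huv
    obtain ⟨i, hi, rfl⟩ := Finset.mem_image.mp hu
    obtain ⟨j, hj, rfl⟩ := Finset.mem_image.mp hv
    exact hE _ _ (hp i hi).2.1 (hp j hj).2.1 huv

theorem foundPrograms_eq_filter (code : Nat.Partrec.Code) {y t : ℕ} (h : y ≤ t) (s : ℕ) :
    foundPrograms code y s = (foundPrograms code t s).filter fun i => programLength i ≤ y := by
  ext i
  simp only [Finset.mem_filter, mem_foundPrograms]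
  constructor
  · exact fun ⟨h1, h2⟩ => ⟨⟨h1, h2.trans h⟩, h2⟩
  · exact fun ⟨⟨h1, _⟩, h2⟩ => ⟨h1, h2⟩

/-- A program of length `k` is counted for all `y ≥ k`, with total weight at most `2 * 2^(-k)`; then
Kraft applies. -/
theorem sum_card_foundPrograms_le {code : Nat.Partrec.Code} {E : Decompressor}
    (hcode : IsCodeOf code E) (hE : PrefixFree E) (t s : ℕ) :
    ∑ y ∈ Finset.range (t + 1), (2⁻¹ : ℝ) ^ y * (foundPrograms code y s).card ≤ 2 := by
  calc ∑ y ∈ Finset.range (t + 1), (2⁻¹ : ℝ) ^ y * (foundPrograms code y s).card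
      = ∑ y ∈ Finset.range (t + 1), ∑ i ∈ foundPrograms code t s,
          if programLength i ≤ y then (2⁻¹ : ℝ) ^ y else 0 := by
        refine Finset.sum_congr rfl fun y hy => ?_
        rw [foundPrograms_eq_filter code (Nat.lt_succ_iff.mp (Finset.mem_range.mp hy)),
          ← Finset.sum_filter, Finset.sum_const, nsmul_eq_mul, mul_comm]
    _ = ∑ i ∈ foundPrograms code t s, ∑ y ∈ Finset.range (t + 1) with programLength i ≤ y,
          (2⁻¹ : ℝ) ^ y := by
        rw [Finset.sum_comm]
        exact Finset.sum_congr rfl fun i _ => (Finset.sum_filter _ _).symm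
    _ ≤ ∑ i ∈ foundPrograms code t s, 2 * (2⁻¹ : ℝ) ^ programLength i := by
        refine Finset.sum_le_sum fun i _ => sum_half_pow_le _ (fun y => y) (fun _ _ _ _ h => h) _ ?_
        exact fun y hy => (Finset.mem_filter.mp hy).2
    _ ≤ 2 := by
        rw [← Finset.mul_sum]
        linarith [sum_half_pow_programLength_le_one hcode hE t s]

theorem sum_two_pow_filter_le (t C : ℕ) :
    ∑ l ∈ Finset.range t with 2 ^ l ≤ C, 2 ^ l ≤ 2 * C := by
  rcases C.eq_zero_or_pos with rfl | hC
  · simp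
  · have h : ∑ l ∈ Finset.range t with 2 ^ l ≤ C, 2 ^ l < 2 ^ (Nat.log 2 C + 1) := by
      refine Nat.geomSum_lt le_rfl fun l hl => ?_
      exact Nat.lt_succ_iff.mpr (Nat.le_log_of_pow_le one_lt_two (Finset.mem_filter.mp hl).2)
    have h2 := Nat.pow_log_le_self 2 hC.ne'
    rw [pow_succ] at h
    omega

/-- Bound each maximum by the sum of `2^(-y)` over all `y` with at least `2^l` programs, then
exchange sums. For fixed `y` the powers `2^l` add up to at most twice the number of programs; the
other factor 2 is from the weighted count. -/
theorem capacity_le_of_two_pow_le_card {code : Nat.Partrec.Code} {E : Decompressor}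
    (hcode : IsCodeOf code E) (hE : PrefixFree E) {X Y : ℕ → ℕ → ℕ} {c t s : ℕ}
    (h : ∀ n < t, ∀ l < t, l + c ≤ X n t → 2 ^ l ≤ (foundPrograms code (Y n t) s).card) :
    capacity X Y c t ≤ 4 * 2 ^ t := by
  have hinc : ∀ l ∈ Finset.range t, (increment X Y (l + c) t : ℝ) ≤
      ∑ y ∈ Finset.range (t + 1),
        if 2 ^ l ≤ (foundPrograms code y s).card then 2 ^ t * (2⁻¹ : ℝ) ^ y else 0 := by
    intro l hl
    have hnonneg : ∀ y ∈ Finset.range (t + 1), (0 : ℝ) ≤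
        if 2 ^ l ≤ (foundPrograms code y s).card then 2 ^ t * (2⁻¹ : ℝ) ^ y else 0 := by
      intro y _
      split_ifs <;> positivity
    rcases increment_eq_zero_or X Y (l + c) t with h0 | ⟨n, hn, hcn, hYt, hinc⟩
    · rw [h0, Nat.cast_zero]
      exact Finset.sum_nonneg hnonneg
    · refine le_trans (le_of_eq ?_)
        (Finset.single_le_sum hnonneg (Finset.mem_range.mpr (Nat.lt_succ_of_le hYt)))
      rw [if_pos (h n hn l (Finset.mem_range.mp hl) hcn), hinc, Nat.cast_pow, Nat.cast_ofNat,
        pow_sub₀ _ two_ne_zero hYt, inv_pow]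
  have hreal : (capacity X Y c t : ℝ) ≤ 4 * 2 ^ t := by
    calc (capacity X Y c t : ℝ)
        = ∑ l ∈ Finset.range t, 2 ^ l * (increment X Y (l + c) t : ℝ) := by
          rw [capacity]; push_cast; rfl
      _ ≤ ∑ l ∈ Finset.range t, 2 ^ l * ∑ y ∈ Finset.range (t + 1),
          if 2 ^ l ≤ (foundPrograms code y s).card then 2 ^ t * (2⁻¹ : ℝ) ^ y else 0 :=
          Finset.sum_le_sum fun l hl => mul_le_mul_of_nonneg_left (hinc l hl) (by positivity)
      _ = ∑ y ∈ Finset.range (t + 1), (2 ^ t * (2⁻¹ : ℝ) ^ y) *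
          (∑ l ∈ Finset.range t with 2 ^ l ≤ (foundPrograms code y s).card, 2 ^ l : ℕ) := by
          simp_rw [Finset.mul_sum]
          rw [Finset.sum_comm]
          refine Finset.sum_congr rfl fun y _ => ?_
          push_cast
          rw [Finset.sum_filter, Finset.mul_sum]
          refine Finset.sum_congr rfl fun l _ => ?_
          split_ifs <;> ring
      _ ≤ ∑ y ∈ Finset.range (t + 1), (2 ^ t * (2⁻¹ : ℝ) ^ y) *
          (2 * (foundPrograms code y s).card) := by
          refine Finset.sum_le_sum fun y _ => mul_le_mul_of_nonneg_left ?_ (by positivity)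
          exact_mod_cast sum_two_pow_filter_le t _
      _ = 2 * 2 ^ t * ∑ y ∈ Finset.range (t + 1), (2⁻¹ : ℝ) ^ y *
          (foundPrograms code y s).card := by
          rw [Finset.mul_sum]
          exact Finset.sum_congr rfl fun y _ => by ring
      _ ≤ 2 * 2 ^ t * 2 := by
          gcongr
          exact sum_card_foundPrograms_le hcode hE t s
      _ = 4 * 2 ^ t := by ring
  exact_mod_cast hreal

theorem exists_complexity_zero_le {E : Decompressor} (hE : IsOptimalPrefixFree E) :
    ∃ e : ℕ, complexity E 0 ≤ e := by
  -- The search stops at once, with value 0, on the empty string and never stops on any other.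
  let E' : Decompressor := fun p => Nat.rfind fun _ => Part.some (decide (p.length ≤ 0))
  have hdom : ∀ p, (E' p).Dom → p = [] := by
    intro p hp
    obtain ⟨v, hv⟩ := Part.dom_iff_mem.mp hp
    simpa using Nat.rfind_spec hv
  have hE' : Partrec E' :=
    Partrec.rfind (Computable₂.partrec₂ (computable_decide_le
      (Computable.list_length.comp Computable.fst) (Computable.const 0)))
  obtain ⟨e, he⟩ := hE.2.2 E' hE' fun p q hp hq _ => by rw [hdom p hp, hdom q hq]
  have h0 : 0 ∈ E' [] := Nat.mem_rfind.mpr ⟨by simp, by simp⟩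
  exact ⟨e, by simpa using (he 0).trans (add_le_add_left (complexity_le_length h0) _)⟩

/-! The tail busy beaver function against the prefix busy beaver function. -/

/-- For every pair `(l + c, y)` dominated by some `(X n t, Y n t)`, at least `⌊i * 2 ^ (l - t)⌋`
programs of length at most `y` are found by the moment `s`. -/
def ManyProgramsFound (code : Nat.Partrec.Code) (X Y : ℕ → ℕ → ℕ) (c t i s : ℕ) : Prop :=
  ∀ n < t, ∀ l < t, ¬ l + c ≤ X n t ∨
    i * 2 ^ l + 1 ≤ ((foundPrograms code (Y n t) s).card + 1) * 2 ^ t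

instance (code : Nat.Partrec.Code) (X Y : ℕ → ℕ → ℕ) (c t i s : ℕ) :
    Decidable (ManyProgramsFound code X Y c t i s) := by
  unfold ManyProgramsFound
  infer_instance

theorem ManyProgramsFound.anti {code : Nat.Partrec.Code} {X Y : ℕ → ℕ → ℕ} {c t i j s : ℕ}
    (h : ManyProgramsFound code X Y c t j s) (hij : i ≤ j) :
    ManyProgramsFound code X Y c t i s := fun n hn l hl =>
  (h n hn l hl).imp_right fun h' => (Nat.succ_le_succ (Nat.mul_le_mul_right _ hij)).trans h'

/-- `s` is the first moment at which `ManyProgramsFound` holds. -/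
def IsFirstMoment (code : Nat.Partrec.Code) (X Y : ℕ → ℕ → ℕ) (c t i s : ℕ) : Prop :=
  ManyProgramsFound code X Y c t i s ∧ ∀ s' < s, ¬ ManyProgramsFound code X Y c t i s'

instance (code : Nat.Partrec.Code) (X Y : ℕ → ℕ → ℕ) (c t i s : ℕ) :
    Decidable (IsFirstMoment code X Y c t i s) := by
  unfold IsFirstMoment
  infer_instance

theorem IsFirstMoment.eq {code : Nat.Partrec.Code} {X Y : ℕ → ℕ → ℕ} {c t i s s' : ℕ}
    (h : IsFirstMoment code X Y c t i s) (h' : IsFirstMoment code X Y c t i s') : s = s' :=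
  le_antisymm (not_lt.mp fun hlt => h.2 _ hlt h'.1) (not_lt.mp fun hlt => h'.2 _ hlt h.1)

section Computability

variable {α : Type*} [Primcodable α]

theorem computable_decide_manyProgramsFound (code : Nat.Partrec.Code) {X Y : ℕ → ℕ → ℕ}
    (hX : Computable₂ X) (hY : Computable₂ Y) {c t i s : α → ℕ} (hc : Computable c)
    (ht : Computable t) (hi : Computable i) (hs : Computable s) :
    Computable fun a => decide (ManyProgramsFound code X Y (c a) (t a) (i a) (s a)) := by
  refine computable_decide_forall_lt (p := fun a n => ∀ l < t a, ¬ l + c a ≤ X n (t a) ∨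
    i a * 2 ^ l + 1 ≤ ((foundPrograms code (Y n (t a)) (s a)).card + 1) * 2 ^ t a) ht ?_
  refine computable_decide_forall_lt (α := α × ℕ) (n := fun b => t b.1)
    (p := fun b l => ¬ l + c b.1 ≤ X b.2 (t b.1) ∨
      i b.1 * 2 ^ l + 1 ≤ ((foundPrograms code (Y b.2 (t b.1)) (s b.1)).card + 1) * 2 ^ t b.1)
    (ht.comp Computable.fst) ?_
  have hfst : Computable fun d : (α × ℕ) × ℕ => d.1.1 := Computable.fst.comp Computable.fst
  have hn : Computable fun d : (α × ℕ) × ℕ => d.1.2 := Computable.snd.comp Computable.fst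
  have ht' := ht.comp hfst
  refine computable_decide_or (α := (α × ℕ) × ℕ)
    (p := fun d => ¬ d.2 + c d.1.1 ≤ X d.1.2 (t d.1.1))
    (q := fun d => i d.1.1 * 2 ^ d.2 + 1 ≤
      ((foundPrograms code (Y d.1.2 (t d.1.1)) (s d.1.1)).card + 1) * 2 ^ t d.1.1)
    (computable_decide_not (computable_decide_le
      (computable_add Computable.snd (hc.comp hfst)) (hX.comp hn ht'))) ?_
  exact computable_decide_le
    (computable_add (computable_mul (hi.comp hfst) (computable_two_pow Computable.snd))
      (Computable.const 1))
    (computable_mul (computable_add ((computable_card_foundPrograms code).comp (hY.comp hn ht')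
      (hs.comp hfst)) (Computable.const 1)) (computable_two_pow ht'))

theorem computable_decide_isFirstMoment (code : Nat.Partrec.Code) {X Y : ℕ → ℕ → ℕ}
    (hX : Computable₂ X) (hY : Computable₂ Y) {c t i s : α → ℕ} (hc : Computable c)
    (ht : Computable t) (hi : Computable i) (hs : Computable s) :
    Computable fun a => decide (IsFirstMoment code X Y (c a) (t a) (i a) (s a)) := by
  refine computable_decide_and
    (q := fun a => ∀ s' < s a, ¬ ManyProgramsFound code X Y (c a) (t a) (i a) s')
    (computable_decide_manyProgramsFound code hX hY hc ht hi hs)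
    (computable_decide_forall_lt
      (p := fun a s' => ¬ ManyProgramsFound code X Y (c a) (t a) (i a) s') hs ?_)
  exact computable_decide_not
    (p := fun b : α × ℕ => ManyProgramsFound code X Y (c b.1) (t b.1) (i b.1) b.2)
    (computable_decide_manyProgramsFound code hX hY (hc.comp Computable.fst)
      (ht.comp Computable.fst) (hi.comp Computable.fst) Computable.snd)

end Computability

/-- The mass `2 ^ (-a - T a)` is placed, for every `a` and every `i < 2 ^ T a`, at a number that
codes `a`, `i` and is at least the corresponding first moment. -/
def momentMass (code : Nat.Partrec.Code) (X Y : ℕ → ℕ → ℕ) (T : ℕ → ℕ) (N : ℕ) : ℝ :=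
  if N.unpair.2.unpair.2 + 1 ≤ 2 ^ T N.unpair.2.unpair.1 ∧
      IsFirstMoment code X Y (2 * N.unpair.2.unpair.1) (T N.unpair.2.unpair.1) N.unpair.2.unpair.2
        N.unpair.1 then
    ((2 : ℝ) ^ (N.unpair.2.unpair.1 + T N.unpair.2.unpair.1))⁻¹
  else 0

theorem momentMass_nonneg (code : Nat.Partrec.Code) (X Y : ℕ → ℕ → ℕ) (T : ℕ → ℕ) (N : ℕ) :
    0 ≤ momentMass code X Y T N := by
  unfold momentMass
  split_ifs <;> positivity

theorem momentMass_pair {code : Nat.Partrec.Code} {X Y : ℕ → ℕ → ℕ} {T : ℕ → ℕ} {a i s : ℕ}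
    (hi : i < 2 ^ T a) (hs : IsFirstMoment code X Y (2 * a) (T a) i s) :
    momentMass code X Y T (Nat.pair s (Nat.pair a i)) = ((2 : ℝ) ^ (a + T a))⁻¹ := by
  simp only [momentMass, Nat.unpair_pair]
  rw [if_pos ⟨hi, hs⟩]

/-- The pair `(a, i)` determines the first moment and hence `N`, so each `a` has at most `2^T a`
pieces, of total mass at most `2^(-a)`. -/
theorem summable_momentMass (code : Nat.Partrec.Code) (X Y : ℕ → ℕ → ℕ) (T : ℕ → ℕ) :
    Summable (momentMass code X Y T) := by
  refine summable_of_sum_le (c := 2) (momentMass_nonneg code X Y T) fun u => ?_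
  let P : ℕ → Prop := fun N => N.unpair.2.unpair.2 + 1 ≤ 2 ^ T N.unpair.2.unpair.1 ∧
    IsFirstMoment code X Y (2 * N.unpair.2.unpair.1) (T N.unpair.2.unpair.1) N.unpair.2.unpair.2
      N.unpair.1
  let φ : ℕ → Σ _ : ℕ, ℕ := fun N => ⟨N.unpair.2.unpair.1, N.unpair.2.unpair.2⟩
  have hinj : Set.InjOn φ (u.filter P) := by
    intro N hN M hM h
    have hN' := (Finset.mem_filter.mp hN).2.2
    have hM' := (Finset.mem_filter.mp hM).2.2
    simp only [φ, Sigma.mk.injEq, heq_eq_eq] at h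
    rw [h.1, h.2] at hN'
    rw [← Nat.pair_unpair N, ← Nat.pair_unpair M, hN'.eq hM', ← Nat.pair_unpair N.unpair.2,
      ← Nat.pair_unpair M.unpair.2, h.1, h.2]
  let A := u.sup fun N => N.unpair.2.unpair.1
  calc ∑ N ∈ u, momentMass code X Y T N
      = ∑ N ∈ u.filter P, ((2 : ℝ) ^ ((φ N).1 + T (φ N).1))⁻¹ :=
        (Finset.sum_filter _ _).symm
    _ = ∑ b ∈ (u.filter P).image φ, ((2 : ℝ) ^ (b.1 + T b.1))⁻¹ := by
        rw [Finset.sum_image hinj]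
    _ ≤ ∑ b ∈ (Finset.range (A + 1)).sigma fun a => Finset.range (2 ^ T a),
          ((2 : ℝ) ^ (b.1 + T b.1))⁻¹ := by
        refine Finset.sum_le_sum_of_subset_of_nonneg ?_ fun _ _ _ => by positivity
        intro b hb
        obtain ⟨N, hN, rfl⟩ := Finset.mem_image.mp hb
        obtain ⟨hNu, hNP⟩ := Finset.mem_filter.mp hN
        simp only [Finset.mem_sigma, Finset.mem_range, φ]
        exact ⟨Nat.lt_succ_of_le (Finset.le_sup (f := fun N => N.unpair.2.unpair.1) hNu), hNP.1⟩
    _ = ∑ a ∈ Finset.range (A + 1), (2⁻¹ : ℝ) ^ a := by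
        rw [Finset.sum_sigma]
        refine Finset.sum_congr rfl fun a _ => ?_
        simp only [Finset.sum_const, Finset.card_range, nsmul_eq_mul, Nat.cast_pow, Nat.cast_ofNat]
        rw [pow_add, inv_pow]
        field_simp
    _ ≤ 2 := by
        simpa using sum_half_pow_le (Finset.range (A + 1)) (fun a => a) (fun _ _ _ _ h => h) 0
          fun _ _ => Nat.zero_le _

theorem isLowerSemicomputableSeries_momentMass (code : Nat.Partrec.Code) {X Y : ℕ → ℕ → ℕ}
    {T : ℕ → ℕ} (hX : Computable₂ X) (hY : Computable₂ Y) (hT : Computable T) :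
    IsLowerSemicomputableSeries (momentMass code X Y T) := by
  refine ⟨momentMass_nonneg code X Y T, summable_momentMass code X Y T, ?_⟩
  have hs : Computable fun b : ℕ × ℕ => b.1.unpair.1 :=
    Computable.fst.comp (Computable.unpair.comp Computable.fst)
  have hai : Computable fun b : ℕ × ℕ => b.1.unpair.2.unpair :=
    Computable.unpair.comp (Computable.snd.comp (Computable.unpair.comp Computable.fst))
  have ha : Computable fun b : ℕ × ℕ => b.1.unpair.2.unpair.1 := Computable.fst.comp hai
  have hi : Computable fun b : ℕ × ℕ => b.1.unpair.2.unpair.2 := Computable.snd.comp hai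
  have hTa := hT.comp ha
  let p : ℕ → ℕ → ℕ := fun N _ =>
    if N.unpair.2.unpair.2 + 1 ≤ 2 ^ T N.unpair.2.unpair.1 ∧
      IsFirstMoment code X Y (2 * N.unpair.2.unpair.1) (T N.unpair.2.unpair.1) N.unpair.2.unpair.2
        N.unpair.1 then 1 else 0
  have hp : Computable₂ p := by
    refine computable_ite (α := ℕ × ℕ)
      (p := fun b => b.1.unpair.2.unpair.2 + 1 ≤ 2 ^ T b.1.unpair.2.unpair.1 ∧
        IsFirstMoment code X Y (2 * b.1.unpair.2.unpair.1) (T b.1.unpair.2.unpair.1)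
          b.1.unpair.2.unpair.2 b.1.unpair.1)
      (computable_decide_and
        (computable_decide_le (computable_add hi (Computable.const 1)) (computable_two_pow hTa))
        (computable_decide_isFirstMoment code hX hY (computable_mul (Computable.const 2) ha) hTa
          hi hs)) (Computable.const 1) (Computable.const 0)
  -- The masses are computable themselves; 1 is subtracted because `ComputableRat` has denominators
  -- `r + 1`.
  let r : ℕ → ℕ → ℕ := fun N _ => 2 ^ (N.unpair.2.unpair.1 + T N.unpair.2.unpair.1) - 1
  have hr : Computable₂ r :=
    computable_sub (computable_two_pow (computable_add ha hTa)) (Computable.const 1)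
  have hr1 : ∀ N k, ((r N k : ℕ) : ℚ) + 1 = 2 ^ (N.unpair.2.unpair.1 + T N.unpair.2.unpair.1) := by
    intro N k
    simp only [r]
    rw [Nat.cast_sub Nat.one_le_two_pow]
    push_cast
    ring
  refine ⟨fun N k => ((p N k : ℚ) - ((0 : ℕ) : ℚ)) / ((r N k : ℚ) + 1),
    ⟨p, fun _ _ => 0, r, hp, Computable.const 0, hr, fun _ _ => rfl⟩, fun N => ?_, fun N => ?_⟩
  · exact fun _ _ _ => le_rfl
  · refine tendsto_const_nhds.congr' (Eventually.of_forall fun k => ?_)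
    simp only [hr1, momentMass, p]
    split_ifs <;> simp

/-- The requirement grows with `i`, so no piece from `i₀` on has its first moment before `s`, and
`Nat.pair` is at least its first component. -/
theorem sum_momentMass_le_tsum {code : Nat.Partrec.Code} {X Y : ℕ → ℕ → ℕ} {T : ℕ → ℕ}
    {a i₀ i s : ℕ} (hi : i ≤ 2 ^ T a)
    (hex : ∀ j < i, ∃ s, ManyProgramsFound code X Y (2 * a) (T a) j s)
    (hs : ∀ s' < s, ¬ ManyProgramsFound code X Y (2 * a) (T a) i₀ s') :
    ((i - i₀ : ℕ) : ℝ) * ((2 : ℝ) ^ (a + T a))⁻¹ ≤ ∑' k, momentMass code X Y T (k + s) := by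
  choose! σ hσ using fun j (hj : j < i) =>
    (⟨Nat.find (hex j hj), Nat.find_spec (hex j hj), fun s' => Nat.find_min (hex j hj)⟩ :
      ∃ s, IsFirstMoment code X Y (2 * a) (T a) j s)
  let pos : ℕ → ℕ := fun j => Nat.pair (σ j) (Nat.pair a j)
  have hpos : ∀ j ∈ Finset.Ico i₀ i, s ≤ pos j := by
    intro j hj
    rw [Finset.mem_Ico] at hj
    refine le_trans (not_lt.mp fun hlt => ?_) (Nat.left_le_pair _ _)
    exact hs _ hlt ((hσ j hj.2).1.anti hj.1)
  have hinj : Set.InjOn (fun j => pos j - s) (Finset.Ico i₀ i) := by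
    intro j hj k hk h
    have h1 := hpos j hj
    have h2 := hpos k hk
    have h3 : pos j = pos k := by simp only at h; omega
    exact (Nat.pair_eq_pair.mp (Nat.pair_eq_pair.mp h3).2).2
  have hsum : Summable fun k => momentMass code X Y T (k + s) :=
    (summable_nat_add_iff s).mpr (summable_momentMass code X Y T)
  refine le_trans (le_of_eq ?_) (hsum.sum_le_tsum ((Finset.Ico i₀ i).image fun j => pos j - s)
    fun _ _ => momentMass_nonneg _ _ _ _ _)
  rw [Finset.sum_image hinj, ← Nat.card_Ico, ← nsmul_eq_mul, ← Finset.sum_const]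
  refine Finset.sum_congr rfl fun j hj => ?_
  rw [Nat.sub_add_cancel (hpos j hj)]
  have hji := (Finset.mem_Ico.mp hj).2
  exact (momentMass_pair (hji.trans_le hi) (hσ j hji)).symm

/-- A shortest program for the busy beaver value outputs at least `s`, so it is not yet counted at
`s` but is counted later. -/
theorem exists_card_lt_card_foundPrograms {code : Nat.Partrec.Code} {E : Decompressor}
    (hcode : IsCodeOf code E) {y b s : ℕ} (hne : (describable E b).Nonempty) (hby : b ≤ y)
    (hs : s ≤ busyBeaver E b) :
    ∃ s', (foundPrograms code y s).card + 1 ≤ (foundPrograms code y s').card := by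
  obtain ⟨p, hp, hlen⟩ := exists_program_of_complexity_le (isGreatest_busyBeaver E b hne).1
  have heval : busyBeaver E b ∈ code.eval (Encodable.encode p) := (hcode _ _).mpr ⟨p, rfl, hp⟩
  obtain ⟨k, hk⟩ := Nat.Partrec.Code.evaln_complete.mp heval
  refine ⟨max (max k s) (busyBeaver E b + 1), ?_⟩
  rw [Nat.succ_le_iff]
  refine Finset.card_lt_card ((Finset.ssubset_iff_of_subset
    (foundPrograms_mono code y ((le_max_right k s).trans (le_max_left _ _)))).mpr
      ⟨Encodable.encode p, ?_, ?_⟩)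
  · refine mem_foundPrograms.mpr ⟨⟨_, Nat.Partrec.Code.evaln_mono
      ((le_max_left k s).trans (le_max_left _ _)) hk, ?_⟩, ?_⟩
    · exact Nat.lt_of_succ_le (le_max_right _ _)
    · simpa [programLength] using hlen.trans hby
  · intro hmem
    obtain ⟨⟨v, hv, hvs⟩, -⟩ := mem_foundPrograms.mp hmem
    have := Part.mem_unique (Nat.Partrec.Code.evaln_sound hv) heval
    omega

theorem exists_busyBeaver_lt_tailBusyBeaver {E : Decompressor} (hE : IsOptimalPrefixFree E)
    {m : ℕ → ℝ} (hm : IsAPriori m) {x y : ℕ → ℕ} {X Y : ℕ → ℕ → ℕ} (hxy : ∀ n, x n ≤ y n)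
    (hX : Computable₂ X) (hY : Computable₂ Y) (hXx : ∀ n t, X n t ≤ x n)
    (hyY : ∀ n t, y n ≤ Y n t) (hcap : ∀ c K, ∃ t, K * 2 ^ t ≤ capacity X Y c t) :
    ∃ n, (describable E (y n)).Nonempty ∧ tailBusyBeaver m (x n) > busyBeaver E (y n) := by
  by_contra! hcon
  obtain ⟨τ, hτ, hτcap⟩ := exists_computable_stage hX hY hcap
  obtain ⟨code, hcode⟩ := exists_isCodeOf hE.1
  obtain ⟨e, he⟩ := exists_complexity_zero_le hE
  -- Any target above the Kraft bound 4 would do. The shift `2 * a` absorbs the factor `2^(-a)` of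
  -- the pieces and the factor `2^a` of domination by `m`.
  let T : ℕ → ℕ := fun a => τ (2 * a) 5
  have hT : Computable T :=
    hτ.comp (computable_mul (Computable.const 2) Computable.id) (Computable.const 5)
  obtain ⟨C, hC⟩ := hm.2 _ (isLowerSemicomputableSeries_momentMass code hX hY hT)
  obtain ⟨a₁, ha₁⟩ := pow_unbounded_of_one_lt C (one_lt_two : (1 : ℝ) < 2)
  let a := max a₁ e
  have haC : C ≤ 2 ^ a := ha₁.le.trans (pow_le_pow_right₀ one_le_two (le_max_left _ _))
  have hmass : ∀ N, momentMass code X Y T N ≤ 2 ^ a * m N := fun N =>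
    (hC N).trans (mul_le_mul_of_nonneg_right haC (hm.1.1 N))
  have hmany : ∀ i ≤ 2 ^ T a, ∃ s, ManyProgramsFound code X Y (2 * a) (T a) i s := by
    intro i
    induction i using Nat.strong_induction_on with
    | _ i ih =>
    intro hi
    have hone : ∀ n < T a, ∀ l < T a, ∀ᶠ s in atTop, ¬ l + 2 * a ≤ X n (T a) ∨
        i * 2 ^ l + 1 ≤ ((foundPrograms code (Y n (T a)) s).card + 1) * 2 ^ T a := by
      intro n _ l hl
      by_cases hX' : l + 2 * a ≤ X n (T a)
      swap
      · exact Eventually.of_forall fun _ => Or.inl hX'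
      suffices h : ∃ s, i * 2 ^ l + 1 ≤
          ((foundPrograms code (Y n (T a)) s).card + 1) * 2 ^ T a by
        obtain ⟨s, hs⟩ := h
        filter_upwards [eventually_ge_atTop s] with s' hs'
        refine Or.inr (hs.trans (Nat.mul_le_mul_right _ (Nat.succ_le_succ ?_)))
        exact Finset.card_le_card (foundPrograms_mono code _ hs')
      have hpow : 2 ^ (T a - l) * 2 ^ l = 2 ^ T a := by
        rw [← pow_add, Nat.sub_add_cancel hl.le]
      -- For small `i` the required number `⌊i * 2^(l-t)⌋` is 0. Otherwise going back `2^(t-l)`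
      -- pieces lowers it by exactly 1.
      rcases lt_or_ge i (2 ^ (T a - l)) with hid | hid
      · refine ⟨0, ?_⟩
        have h1 : i * 2 ^ l < 2 ^ T a := hpow ▸ Nat.mul_lt_mul_of_pos_right hid (by positivity)
        rw [add_mul, one_mul]
        omega
      · have hi₀ : i - 2 ^ (T a - l) < i := Nat.sub_lt_of_pos_le (by positivity) hid
        have hex := ih _ hi₀ (hi₀.le.trans hi)
        set s₀ := Nat.find hex with hs₀
        have htail := sum_momentMass_le_tsum (s := s₀) hi (fun j hj => ih j hj (hj.le.trans hi))
          (fun s' hs' => Nat.find_min hex hs')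
        have hsm : Summable fun k => m (k + s₀) := (summable_nat_add_iff s₀).mpr hm.1.2.1
        have hle : ∑' k, momentMass code X Y T (k + s₀) ≤ 2 ^ a * ∑' k, m (k + s₀) := by
          rw [← tsum_mul_left]
          exact Summable.tsum_le_tsum (fun k => hmass _)
            ((summable_nat_add_iff s₀).mpr (summable_momentMass code X Y T)) (hsm.mul_left _)
        have hxn := hX'.trans (hXx n (T a))
        have htail' : (2⁻¹ : ℝ) ^ x n ≤ ∑' k, m (k + s₀) := by
          have h1 := htail.trans hle
          rw [Nat.sub_sub_self hid] at h1
          have h2 : (2 : ℝ) ^ a * 2⁻¹ ^ (l + 2 * a) =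
              ((2 ^ (T a - l) : ℕ) : ℝ) * (2 ^ (a + T a))⁻¹ := by
            have h3 : (2 : ℝ) ^ T a = 2 ^ (T a - l) * 2 ^ l := by exact_mod_cast hpow.symm
            rw [pow_add 2 a (T a), h3, inv_pow, pow_add, two_mul, pow_add]
            push_cast
            field_simp
          rw [← h2] at h1
          refine le_trans (pow_le_pow_of_le_one (by norm_num) (by norm_num) hxn) ?_
          exact le_of_mul_le_mul_left h1 (by positivity)
        -- `y n ≥ x n ≥ 2 * a ≥ e`, so 0 is describable.
        have hne : (describable E (y n)).Nonempty := by
          refine ⟨0, he.trans ?_⟩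
          have h1 : e ≤ a := le_max_right _ _
          have h2 := hxy n
          exact_mod_cast (by omega : e ≤ y n)
        have hs := (le_tailBusyBeaver hm.1.1 hm.1.2.1 htail').trans (hcon n hne)
        obtain ⟨s', hs'⟩ := exists_card_lt_card_foundPrograms hcode hne (hyY n (T a)) hs
        refine ⟨s', ?_⟩
        -- At `s₀` the requirement for `i - 2^(t-l)` holds; the new program supplies the missing
        -- unit.
        have h1 := ((Nat.find_spec hex) n ‹_› l hl).resolve_left (not_not.mpr hX')
        rw [← hs₀, Nat.sub_mul, hpow] at h1
        have h2 : 2 ^ T a ≤ i * 2 ^ l := hpow ▸ Nat.mul_le_mul_right _ hid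
        have h3 := Nat.mul_le_mul_right (2 ^ T a) (Nat.succ_le_succ hs')
        rw [Nat.succ_eq_add_one, add_mul _ 1, one_mul] at h3
        simp only [Nat.succ_eq_add_one] at h3
        omega
    have hall : ∀ᶠ s in atTop, ∀ n ∈ Finset.range (T a), ∀ l ∈ Finset.range (T a),
        ¬ l + 2 * a ≤ X n (T a) ∨
          i * 2 ^ l + 1 ≤ ((foundPrograms code (Y n (T a)) s).card + 1) * 2 ^ T a := by
      simp only [Finset.eventually_all]
      exact fun n hn l hl => hone n (Finset.mem_range.mp hn) l (Finset.mem_range.mp hl)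
    obtain ⟨s, hs⟩ := hall.exists
    exact ⟨s, fun n hn l hl => hs n (Finset.mem_range.mpr hn) l (Finset.mem_range.mpr hl)⟩
  obtain ⟨s, hs⟩ := hmany _ le_rfl
  have h1 : capacity X Y (2 * a) (T a) ≤ 4 * 2 ^ T a := by
    refine capacity_le_of_two_pow_le_card hcode hE.2.1 (s := s) fun n hn l hl hl' => ?_
    have h2 := (hs n hn l hl).resolve_left (not_not.mpr hl')
    rw [mul_comm] at h2
    exact Nat.lt_succ_iff.mp (Nat.lt_of_mul_lt_mul_right (Nat.lt_of_succ_le h2))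
  have h2 : 5 * 2 ^ T a ≤ capacity X Y (2 * a) (T a) := hτcap (2 * a) 5
  have h3 : 0 < 2 ^ T a := by positivity
  omega

end BusyBeaver

end

open BusyBeaver in
theorem theorem2
    (D : Decompressor) (hD : IsOptimal D)
    (E : Decompressor) (hE : IsOptimalPrefixFree E)
    (m : ℕ → ℝ) (hm : IsAPriori m)
    (x y : ℕ → ℕ)
    (hdistinct : Function.Injective fun n : ℕ => (x n, y n))
    (hxy : ∀ n : ℕ, x n ≤ y n)
    (hx : LowerSemicomputable fun n : ℕ => (x n : ℝ))
    (hy : UpperSemicomputable fun n : ℕ => (y n : ℝ))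
    (hdiv : ¬ Summable fun n : ℕ => (2 : ℝ) ^ ((x n : ℤ) - (y n : ℤ))) :
    (∃ n : ℕ, busyBeaver D (x n) > tailBusyBeaver m (y n)) ∧
      (∃ n : ℕ, (describable E (y n)).Nonempty ∧
        tailBusyBeaver m (x n) > busyBeaver E (y n)) := by
  obtain ⟨X, hX, hXx, hXlim⟩ := exists_computable_approx_below hx
  obtain ⟨Y, hY, hyY, hYlim⟩ := exists_computable_approx_above hy
  have hcap := exists_le_capacity hdistinct hxy hXlim hYlim hdiv
  exact ⟨exists_tailBusyBeaver_lt_busyBeaver hD hm.1 hX hY hXx hyY hcap,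
    exists_busyBeaver_lt_tailBusyBeaver hE hm hxy hX hY hXx hyY hcap⟩
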